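/- Let $X\subset\mathbb{R}^n$ be a nonempty finite set of points, $\epsilon\ge 0$, and $\sigma$ a degree-compatible term ordering on the terms of $\mathbb{R}[x_1,\dots,x_n]$. Notation. For a polynomial $h$, let $h(X)=(h(\mathbf{x}))_{\mathbf{x}\in X}$; $h$ is $\epsilon$-approximately vanishing for $X$ if $\|h(X)\|_2\le\epsilon$. The gradient norm of a non-constant term $t$ is $\|t\|_{g,X}=\big(\sum_{\mathbf{x}\in X}\|\nabla t(\mathbf{x})\|_2^2\big)^{1/2}\big/\big(\sum_{k}\deg_k(t)^2\big)^{1/2}$, and $\|1\|_{g,X}=0$. The gradient-weighted norm of $g=\sum_i c_it_i$ is $\|g\|_{gw,X}=\big(\sum_i c_i^2\|t_i\|_{g,X}^2\big)^{1/2}$, and $g$ is gradient-weighted unitary if $\|g\|_{gw,X}=1$. An ideal is an $\epsilon$-approximate vanishing ideal for $X$ if it is generated by a set of polynomials of coefficient norm $1$ that are $\epsilon$-approximately vanishing for $X$. For a finite set $\mathcal{O}$ of terms, $\partial\mathcal{O}=(\bigcup_k x_k\mathcal{O})\setminus\mathcal{O}$; $\mathcal{O}$ is an order ideal if it is closed under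 taking divisors, and then an $\mathcal{O}$-border prebasis is a set consisting of one polynomial $b-\sum_{o\in\mathcal{O}}c_{b,o}\,o$ with $c_{b,o}\in\mathbb{R}$ for each $b\in\partial\mathcal{O}$. Algorithm (ABM with gradient-weighted normalization). Start with $G=\emptyset$, $\mathcal{O}=\{1\}$. For $d=1,2,\dots$: let $L=\{b\in\partial\mathcal{O}\mid\deg b=d\}$; if $L=\emptyset$, output $(G,\mathcal{O})$ and stop. Otherwise go through the $b\in L$ in $\sigma$-ascending order. For each $b$, with the current $\mathcal{O}=\{o_1,\dots,o_s\}$, let $M=(b(X)\ o_1(X)\ \cdots\ o_s(X))$ and $D=\mathrm{diag}(\|b\|_{gw,X},\|o_1\|_{gw,X},\dots,\|o_s\|_{gw,X})$, and take the smallest real generalized eigenvalue $\lambda$ of $M^\top M\mathbf{v}=\lambda D^2\mathbf{v}$ and a corresponding eigenvector $\mathbf{v}$ normalized by $\mathbf{v}^\top D^2\mathbf{v}=1$. If $\sqrt{\lambda}\le\epsilon$, add $g=v_1b+v_2o_1+\cdots+v_{s+1}o_s$ to $G$; otherwise add $b$ to $\mathcal{O}$. The Buchberger–Möller algorithm for border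 bases with gradient-weighted normalization is the same loop, in which for each $b$ one tests whether the columns of $M$ are linearly dependent: if so, one takes a nonzero $\mathbf{w}$ with $M\mathbf{w}=0$, puts $h=w_1b+w_2o_1+\cdots+w_{s+1}o_s$ and adds $h/\|h\|_{gw,X}$ to $G$; if not, one adds $b$ to $\mathcal{O}$. Theorem. Whatever eigenvectors are chosen, the ABM algorithm with gradient-weighted normalization can be carried out and terminates (all the required generalized eigenvalues and normalized eigenvectors exist), and every output $(G,\mathcal{O})$ has the following properties. 1. Every $g\in G$ is gradient-weighted unitary and $\epsilon$-approximately vanishing for $X$, and the ideal generated by $G$ is an $\epsilon$-approximate vanishing ideal for $X$. 2. No gradient-weighted unitary polynomial in the linear span of $\mathcal{O}$ is $\epsilon$-approximately vanishing for $X$. 3. If $\mathcal{O}$ is an order ideal, then $\widetilde G=\{\frac{1}{\mathrm{LC}_\sigma(g)}\,g\mid g\in G\}$ is an $\mathcal{O}$-border prebasis, where $\mathrm{LC}_\sigma(g)$ is the leading coefficient of $g$ with respect to $\sigma$. 4. If $\epsilon=0$, the algorithm produces the same results as the Buchberger–Möller algorithm for border bases with gradient-weighted normalization: a pair $(G,\mathcal{O})$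 is a possible output of the one if and only if it is a possible output of the other (with arbitrary choices of the eigenvectors and of the kernel vectors). -/

import Mathlib

open MvPolynomial
open scoped MonomialOrder Matrix

namespace GWBorder

noncomputable section

/-- Terms `x₁^{α₁} ⋯ xₙ^{αₙ}`, represented by their exponents: the product of terms is `+`,
divisibility of terms is `≤`, and the term `1` is `0`. -/
abbrev Term (n : ℕ) := Fin n →₀ ℕ

/-- The polynomial ring `ℝ[x₁, …, xₙ]`. -/
abbrev RPoly (n : ℕ) := MvPolynomial (Fin n) ℝ

variable {n : ℕ}

/-! ### Evaluation vectors and norms -/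

/-- The evaluation vector `h(X)`. -/
def evalVec (X : Finset (Fin n → ℝ)) (h : RPoly n) : EuclideanSpace ℝ X :=
  WithLp.toLp 2 fun x => eval (x : Fin n → ℝ) h

/-- The evaluation vector `∇h(X)` of the gradient. -/
def gradVec (X : Finset (Fin n → ℝ)) (h : RPoly n) : EuclideanSpace ℝ (X × Fin n) :=
  WithLp.toLp 2 fun p => eval (p.1 : Fin n → ℝ) (pderiv p.2 h)

/-- The coefficient norm. -/
def coeffNorm (g : RPoly n) : ℝ :=
  Real.sqrt (∑ t ∈ g.support, coeff t g ^ 2)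

/-- The gradient norm `‖∇g(X)‖ / Z` with `Z = √(∑ₖ degₖ(g)²)`. For a constant polynomial this is
`0 / 0 = 0`, which is the value wanted there. -/
def gradNorm (X : Finset (Fin n → ℝ)) (g : RPoly n) : ℝ :=
  ‖gradVec X g‖ / Real.sqrt (∑ k : Fin n, (degreeOf k g : ℝ) ^ 2)

/-- The gradient-weighted norm `√(∑ᵢ cᵢ² ‖tᵢ‖²)` of `g = ∑ᵢ cᵢ tᵢ`, where the norm of the term `tᵢ`
is its gradient norm. -/
def gwNorm (X : Finset (Fin n → ℝ)) (g : RPoly n) : ℝ :=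
  Real.sqrt (∑ t ∈ g.support, coeff t g ^ 2 * gradNorm X (monomial t 1) ^ 2)

/-- Unitary with respect to the coefficient norm. -/
def IsUnitary (g : RPoly n) : Prop := coeffNorm g = 1

/-- Unitary with respect to the gradient-weighted norm. -/
def IsGWUnitary (X : Finset (Fin n → ℝ)) (g : RPoly n) : Prop := gwNorm X g = 1

/-- `g` is `ε`-approximately vanishing for `X`. -/
def IsApproxVanishing (ε : ℝ) (X : Finset (Fin n → ℝ)) (g : RPoly n) : Prop :=
  ‖evalVec X g‖ ≤ ε

/-- `I` is an `ε`-approximate vanishing ideal for `X`: it is generated by a system of unitary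
polynomials that are `ε`-approximately vanishing for `X`. -/
def IsApproxVanishingIdeal (ε : ℝ) (X : Finset (Fin n → ℝ)) (I : Ideal (RPoly n)) : Prop :=
  ∃ H : Set (RPoly n), (∀ h ∈ H, IsUnitary h ∧ IsApproxVanishing ε X h) ∧ Ideal.span H = I

/-! ### Order ideals and border prebases -/

/-- A finite set of terms that is closed under taking divisors. -/
def IsOrderIdeal (O : Finset (Term n)) : Prop :=
  ∀ o ∈ O, ∀ t : Term n, t ≤ o → t ∈ O

/-- The border `(⋃ₖ xₖ O) \ O`. -/
def border (O : Finset (Term n)) : Finset (Term n) :=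
  (Finset.univ.biUnion fun k : Fin n => O.image fun o => Finsupp.single k 1 + o) \ O

/-- The vector space `Span(O)` of the linear combinations of the terms in `O`. -/
def termSpan (O : Finset (Term n)) : Submodule ℝ (RPoly n) :=
  Submodule.span ℝ ((fun t : Term n => (monomial t (1 : ℝ) : RPoly n)) '' (O : Set (Term n)))

/-- An `O`-border prebasis: `O` is an order ideal and `H` consists of one polynomial
`b - ∑_{o ∈ O} c_{b,o} o` for each border term `b`. -/
def IsBorderPrebasis (O : Finset (Term n)) (H : Set (RPoly n)) : Prop :=
  IsOrderIdeal O ∧ ∃ c : Term n → Term n → ℝ,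
    H = {p | ∃ b ∈ border O, p = monomial b 1 - ∑ o ∈ O, monomial o (c b o)}

/-- The term ordering `σ` is degree-compatible. -/
def IsDegreeCompatible (σ : MonomialOrder (Fin n)) : Prop :=
  ∀ s t : Term n, s.degree < t.degree → s ≺[σ] t

/-! ### Generalized eigenvalue problems -/

/-- The real generalized eigenvalues of `(A, B)`. -/
def genEigenvalues {ι : Type*} [Fintype ι] (A B : Matrix ι ι ℝ) : Set ℝ :=
  {μ | ∃ v : ι → ℝ, v ≠ 0 ∧ A *ᵥ v = μ • (B *ᵥ v)}

/-- `l` is the smallest generalized eigenvalue of `(A, B)` and `v` is a generalized eigenvector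
for it, normalized by `vᵀ B v = 1`. -/
def SolvesGEP {ι : Type*} [Fintype ι] (A B : Matrix ι ι ℝ) (l : ℝ) (v : ι → ℝ) : Prop :=
  IsLeast (genEigenvalues A B) l ∧ A *ᵥ v = l • (B *ᵥ v) ∧ v ⬝ᵥ (B *ᵥ v) = 1

/-- The evaluation matrix of a finite set of terms: its columns are the evaluation vectors. -/
def evalMatrix (X : Finset (Fin n → ℝ)) (T : Finset (Term n)) : Matrix X T ℝ :=
  Matrix.of fun x t => eval (x : Fin n → ℝ) (monomial (t : Term n) (1 : ℝ))

/-- The diagonal matrix of the gradient-weighted norms of the terms in `T`. -/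
def weightMatrix (X : Finset (Fin n → ℝ)) (T : Finset (Term n)) : Matrix T T ℝ :=
  Matrix.diagonal fun t => gwNorm X (monomial (t : Term n) (1 : ℝ))

/-- The polynomial `∑_{t ∈ T} v_t t`. -/
def polyOfVec {T : Finset (Term n)} (v : T → ℝ) : RPoly n :=
  ∑ t : T, monomial (t : Term n) (v t)

/-! ### The degree-by-degree border algorithms

The approximate and the exact algorithm share the loop over the degrees and the border terms. They
differ in the treatment of a single border term `b` for the current set `O` of order terms. Its
result is either `some g` (the polynomial `g` is to be added to `G`) or `none` (the term `b` is to
be added to `O`). As an eigenvector or a kernel vector is not unique, the treatment is a relation,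
and so is the whole algorithm: it relates an input to every output that it can produce. -/

/-- The state: the current `G` and `O`, the degree `d`, and the set `L` of the terms of degree `d`
that are still to be treated. -/
structure State (n : ℕ) where
  G : Set (RPoly n)
  O : Finset (Term n)
  d : ℕ
  L : Finset (Term n)

/-- The border terms of degree `d`. -/
def borderOfDegree (O : Finset (Term n)) (d : ℕ) : Finset (Term n) :=
  (border O).filter fun b => b.degree = d

/-- `b` is the `σ`-smallest element of `L`. -/
def IsSmallest (σ : MonomialOrder (Fin n)) (L : Finset (Term n)) (b : Term n) : Prop :=
  b ∈ L ∧ ∀ c ∈ L, b ≼[σ] c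

/-- The initial state: `G = ∅`, `O = {1}`, and nothing is left to do in degree `0`. -/
def initState (n : ℕ) : State n := ⟨∅, {0}, 0, ∅⟩

/-- One step of the algorithm whose treatment of a border term is `treat`. -/
inductive Step (treat : Finset (Term n) → Term n → Option (RPoly n) → Prop)
    (σ : MonomialOrder (Fin n)) : State n → State n → Prop
  /-- Nothing is left in degree `d`, and there are border terms of degree `d + 1`. -/
  | nextDegree (G : Set (RPoly n)) (O : Finset (Term n)) (d : ℕ)
      (h : borderOfDegree O (d + 1) ≠ ∅) :
      Step treat σ ⟨G, O, d, ∅⟩ ⟨G, O, d + 1, borderOfDegree O (d + 1)⟩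
  /-- The smallest remaining term `b` yields a polynomial `g`. -/
  | addPolynomial (G : Set (RPoly n)) (O : Finset (Term n)) (d : ℕ) (L : Finset (Term n))
      (b : Term n) (g : RPoly n) (hb : IsSmallest σ L b) (hg : treat O b (some g)) :
      Step treat σ ⟨G, O, d, L⟩ ⟨G ∪ {g}, O, d, L.erase b⟩
  /-- The smallest remaining term `b` becomes an order term. -/
  | addTerm (G : Set (RPoly n)) (O : Finset (Term n)) (d : ℕ) (L : Finset (Term n))
      (b : Term n) (hb : IsSmallest σ L b) (hg : treat O b none) :
      Step treat σ ⟨G, O, d, L⟩ ⟨G, insert b O, d, L.erase b⟩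

/-- The algorithm stops in this state: nothing is left in degree `d`, and there are no border terms
of degree `d + 1`. -/
def IsFinal (S : State n) : Prop := S.L = ∅ ∧ borderOfDegree S.O (S.d + 1) = ∅

/-- The state `S` can occur in a run of the algorithm. -/
def Reachable (treat : Finset (Term n) → Term n → Option (RPoly n) → Prop)
    (σ : MonomialOrder (Fin n)) (S : State n) : Prop :=
  Relation.ReflTransGen (Step treat σ) (initState n) S

/-- The algorithm always terminates: it is never stuck before it reaches a final state, and it has
no infinite run. -/
def Terminates (treat : Finset (Term n) → Term n → Option (RPoly n) → Prop)
    (σ : MonomialOrder (Fin n)) : Prop :=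
  (∀ S, Reachable treat σ S → IsFinal S ∨ ∃ S', Step treat σ S S') ∧
  ¬ ∃ run : ℕ → State n, run 0 = initState n ∧ ∀ i, Step treat σ (run i) (run (i + 1))

/-- `(G, O)` is an output of the algorithm. -/
def Outputs (treat : Finset (Term n) → Term n → Option (RPoly n) → Prop)
    (σ : MonomialOrder (Fin n)) (G : Set (RPoly n)) (O : Finset (Term n)) : Prop :=
  ∃ S, Reachable treat σ S ∧ IsFinal S ∧ S.G = G ∧ S.O = O

/-- The treatment of `b` in the ABM algorithm with gradient-weighted normalization: with
`M = (b(X) O(X))` and `D` the diagonal matrix of the gradient-weighted norms of `b` and of the terms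
in `O`, solve `MᵀM v = l D² v` for the smallest `l`. If `√l ≤ ε`, the result is the polynomial with
coefficient vector `v`; otherwise `b` is an order term. -/
def abmTreat (X : Finset (Fin n → ℝ)) (ε : ℝ) (O : Finset (Term n)) (b : Term n)
    (r : Option (RPoly n)) : Prop :=
  ∃ (l : ℝ) (v : ↥(insert b O) → ℝ),
    SolvesGEP ((evalMatrix X (insert b O))ᵀ * evalMatrix X (insert b O))
      (weightMatrix X (insert b O) ^ 2) l v ∧
    ((Real.sqrt l ≤ ε ∧ r = some (polyOfVec v)) ∨ (ε < Real.sqrt l ∧ r = none))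

/-- The treatment of `b` in the (exact) Buchberger–Möller algorithm for border bases with
gradient-weighted normalization: if `M = (b(X) O(X))` has a nonzero kernel vector `w`, the result is
the polynomial with coefficient vector `w`, divided by its gradient-weighted norm; if the columns of
`M` are linearly independent, `b` is an order term. -/
def bmTreat (X : Finset (Fin n → ℝ)) (O : Finset (Term n)) (b : Term n)
    (r : Option (RPoly n)) : Prop :=
  (∃ w : ↥(insert b O) → ℝ, w ≠ 0 ∧ evalMatrix X (insert b O) *ᵥ w = 0 ∧
      r = some ((gwNorm X (polyOfVec w))⁻¹ • polyOfVec w)) ∨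
  (LinearIndependent ℝ (evalMatrix X (insert b O)).col ∧ r = none)

end

end GWBorder

open GWBorder

/-! For a coefficient vector `v` with polynomial `g = polyOfVec v`, the forms of `MᵀM` and `D²` are
`‖g(X)‖²` and the squared gradient-weighted norm of `g`. The smallest generalized eigenvalue is
therefore the minimum of `‖g(X)‖²` over the gradient-weighted unitary `g` in the span of the terms.
`D` is singular, because the term `1` has weight `0`, but `MᵀM + D²` is definite
(`eq_zero_of_gwNorm_eq_zero`), and this suffices (`exists_solvesGEP`).

The loop preserves `Admissible`: on gradient-weighted unitary polynomials in the span of `O` the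
evaluation norm exceeds `ε`. This is claim 2. It also makes evaluation on `X` injective on that
span, so an order term `o` does not vanish on `X`, the border term `xₖ o` has nonzero weight, and
the next eigenproblem is solvable. Injectivity gives `|O| ≤ |X|`, which bounds the degrees and
yields termination. Finally, it forces `b` to occur in the polynomial found for `b`
(`Admissible.isYield`), which gives claim 3 (`Invariant.isBorderPrebasis`).

For `ε = 0`, eigenvalue `0` means a nontrivial kernel of `M`. The ideal in claim 1 needs a separate
argument (`isApproxVanishingIdeal_span`), since its generators are normalized in a different norm.
-/

namespace GWBorder

variable {n : ℕ}

/-! ### Generalized eigenvalue problems -/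

section GEP

variable {ι : Type*} [Fintype ι] {A B : Matrix ι ι ℝ}

/-- A semidefinite pencil `(A, B)` with `A + B` definite and `B ≠ 0` has a smallest generalized
eigenvalue, and it is a lower bound of the generalized Rayleigh quotient. -/
theorem exists_solvesGEP (hA : A.PosSemidef) (hB : B.PosSemidef)
    (hAB : ∀ w : ι → ℝ, w ≠ 0 → 0 < w ⬝ᵥ (A *ᵥ w) + w ⬝ᵥ (B *ᵥ w))
    {u : ι → ℝ} (hu : 0 < u ⬝ᵥ (B *ᵥ u)) :
    ∃ l v, SolvesGEP A B l v ∧ ∀ w, l * (w ⬝ᵥ (B *ᵥ w)) ≤ w ⬝ᵥ (A *ᵥ w) := by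
  classical
  have hA0 : ∀ w : ι → ℝ, 0 ≤ w ⬝ᵥ (A *ᵥ w) := fun w => by
    simpa using hA.dotProduct_mulVec_nonneg w
  have hB0 : ∀ w : ι → ℝ, 0 ≤ w ⬝ᵥ (B *ᵥ w) := fun w => by
    simpa using hB.dotProduct_mulVec_nonneg w
  -- `B` may be singular, so the quotient of `A` by `B` is replaced by that of `B` by the definite
  -- `A + B`. A maximum `μ` of the latter corresponds to the minimum `μ⁻¹ - 1` of the former.
  set f : (ι → ℝ) → ℝ := fun w => (w ⬝ᵥ (B *ᵥ w)) / (w ⬝ᵥ (A *ᵥ w) + w ⬝ᵥ (B *ᵥ w)) with hf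
  have hne : ∀ w ∈ Metric.sphere (0 : ι → ℝ) 1, w ≠ 0 := by
    rintro w hw rfl
    simp at hw
  have hcont : ContinuousOn f (Metric.sphere 0 1) := by
    have h1 : Continuous fun w : ι → ℝ => w ⬝ᵥ (A *ᵥ w) := by fun_prop
    have h2 : Continuous fun w : ι → ℝ => w ⬝ᵥ (B *ᵥ w) := by fun_prop
    exact h2.continuousOn.div (h1.add h2).continuousOn fun w hw => (hAB w (hne w hw)).ne'
  have hu0 : u ≠ 0 := by
    rintro rfl
    simp at hu
  have hscale : ∀ (C : Matrix ι ι ℝ) (c : ℝ) (w : ι → ℝ),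
      (c • w) ⬝ᵥ (C *ᵥ (c • w)) = c ^ 2 * (w ⬝ᵥ (C *ᵥ w)) := fun C c w => by
    simp [Matrix.mulVec_smul]; ring
  have hnorm : ∀ w : ι → ℝ, w ≠ 0 → ‖w‖⁻¹ • w ∈ Metric.sphere (0 : ι → ℝ) 1 := fun w hw => by
    simp [norm_smul, hw]
  obtain ⟨v, hv, hmax⟩ := (isCompact_sphere (0 : ι → ℝ) 1).exists_isMaxOn
    ⟨_, hnorm u hu0⟩ hcont
  have hmax' : ∀ w, w ≠ 0 → f w ≤ f v := fun w hw => by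
    have h := hmax (hnorm w hw)
    have hw' : (‖w‖⁻¹) ^ 2 ≠ 0 := by simp [hw]
    simp only [Set.mem_ofPred_eq, hf, hscale, ← mul_add] at h
    rwa [mul_div_mul_left _ _ hw'] at h
  have hv0 := hne v hv
  have hCv := hAB v hv0
  set μ := f v with hμ
  have hμpos : 0 < μ := lt_of_lt_of_le (div_pos hu (hAB u hu0)) (hmax' u hu0)
  have hq : ∀ w, w ⬝ᵥ (B *ᵥ w) ≤ μ * (w ⬝ᵥ (A *ᵥ w) + w ⬝ᵥ (B *ᵥ w)) := fun w => by
    by_cases hw : w = 0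
    · simp [hw]
    · exact (div_le_iff₀ (hAB w hw)).1 (hmax' w hw)
  have hqv : v ⬝ᵥ (B *ᵥ v) = μ * (v ⬝ᵥ (A *ᵥ v) + v ⬝ᵥ (B *ᵥ v)) :=
    (div_eq_iff hCv.ne').1 rfl
  have hBv : 0 < v ⬝ᵥ (B *ᵥ v) := hqv ▸ mul_pos hμpos hCv
  -- Maximality makes this matrix semidefinite with a null value at `v`; a semidefinite matrix then
  -- kills `v`, which is the eigenvector equation.
  have hP : (μ • (A + B) - B).PosSemidef := by
    refine Matrix.PosSemidef.of_dotProduct_mulVec_nonneg ?_ fun w => ?_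
    · refine Matrix.IsHermitian.sub ?_ hB.1
      exact (hA.1.add hB.1).smul (by simp [IsSelfAdjoint])
    · have := hq w
      simp only [Matrix.sub_mulVec, Matrix.smul_mulVec, Matrix.add_mulVec, dotProduct_sub,
        dotProduct_smul, dotProduct_add, star_trivial, smul_eq_mul]
      linarith
  have hker : (μ • (A + B) - B) *ᵥ v = 0 := by
    rw [← hP.dotProduct_mulVec_zero_iff]
    simp only [Matrix.sub_mulVec, Matrix.smul_mulVec, Matrix.add_mulVec, dotProduct_sub,
        dotProduct_smul, dotProduct_add, star_trivial, smul_eq_mul]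
    linarith
  have hAv : A *ᵥ v = (μ⁻¹ - 1) • (B *ᵥ v) := by
    have h : B *ᵥ v = μ • (A *ᵥ v + B *ᵥ v) := by
      simpa [Matrix.sub_mulVec, Matrix.smul_mulVec, Matrix.add_mulVec, sub_eq_zero, eq_comm]
        using hker
    have h' : μ⁻¹ • (B *ᵥ v) = A *ᵥ v + B *ᵥ v := by
      conv_lhs => rw [h]
      rw [smul_smul, inv_mul_cancel₀ hμpos.ne', one_smul]
    rw [sub_smul, h', one_smul, add_sub_cancel_right]
  have hlow : ∀ w, (μ⁻¹ - 1) * (w ⬝ᵥ (B *ᵥ w)) ≤ w ⬝ᵥ (A *ᵥ w) := fun w => by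
    have h := mul_le_mul_of_nonneg_left (hq w) (inv_pos.2 hμpos).le
    rw [← mul_assoc, inv_mul_cancel₀ hμpos.ne'] at h
    linarith
  refine ⟨μ⁻¹ - 1, (Real.sqrt (v ⬝ᵥ (B *ᵥ v)))⁻¹ • v, ⟨⟨⟨v, hv0, hAv⟩, ?_⟩, ?_, ?_⟩, hlow⟩
  · rintro m ⟨w, hw, hw'⟩
    have hAw : w ⬝ᵥ (A *ᵥ w) = m * (w ⬝ᵥ (B *ᵥ w)) := by rw [hw', dotProduct_smul, smul_eq_mul]
    have hBw : 0 < w ⬝ᵥ (B *ᵥ w) := by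
      refine (hB0 w).lt_of_ne fun h => ?_
      have := hAB w hw
      rw [hAw, ← h] at this
      simp at this
    have := hlow w
    rw [hAw] at this
    exact le_of_mul_le_mul_right this hBw
  · rw [Matrix.mulVec_smul, Matrix.mulVec_smul, hAv, smul_comm]
  · rw [hscale, inv_pow, Real.sq_sqrt hBv.le, inv_mul_cancel₀ hBv.ne']

end GEP

/-! ### Coefficient vectors -/

theorem coeff_polyOfVec {T : Finset (Term n)} (v : T → ℝ) (t : T) :
    coeff (t : Term n) (polyOfVec v) = v t := by
  classical
  simp only [polyOfVec, coeff_sum, coeff_monomial, Subtype.coe_inj]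
  simp

theorem coeff_polyOfVec_of_notMem {T : Finset (Term n)} (v : T → ℝ) {t : Term n} (ht : t ∉ T) :
    coeff t (polyOfVec v) = 0 := by
  classical
  simp only [polyOfVec, coeff_sum, coeff_monomial]
  refine Finset.sum_eq_zero fun s _ => if_neg ?_
  rintro rfl
  exact ht s.2

theorem support_polyOfVec_subset {T : Finset (Term n)} (v : T → ℝ) :
    (polyOfVec v).support ⊆ T := fun t ht => by
  by_contra h
  exact mem_support_iff.1 ht (coeff_polyOfVec_of_notMem v h)

theorem polyOfVec_coeff {T : Finset (Term n)} {h : RPoly n} (hh : h.support ⊆ T) :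
    polyOfVec (fun t : T => coeff (t : Term n) h) = h := by
  ext t
  by_cases ht : t ∈ T
  · exact coeff_polyOfVec _ ⟨t, ht⟩
  · rw [coeff_polyOfVec_of_notMem _ ht]
    exact (notMem_support_iff.1 fun h' => ht (hh h')).symm

theorem polyOfVec_smul {T : Finset (Term n)} (c : ℝ) (v : T → ℝ) :
    polyOfVec (c • v) = c • polyOfVec v := by
  simp [polyOfVec, Finset.smul_sum, smul_monomial]

theorem mem_termSpan_iff {T : Finset (Term n)} {h : RPoly n} :
    h ∈ termSpan T ↔ h.support ⊆ T := by
  constructor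
  · intro hh t ht
    by_contra htT
    refine mem_support_iff.1 ht ?_
    have : termSpan T ≤ LinearMap.ker (lcoeff ℝ t : RPoly n →ₗ[ℝ] ℝ) := by
      refine Submodule.span_le.2 ?_
      rintro _ ⟨s, hs, rfl⟩
      simp only [SetLike.mem_coe, LinearMap.mem_ker, lcoeff_apply, coeff_monomial]
      refine if_neg ?_
      rintro rfl
      exact htT hs
    exact this hh
  · intro hh
    rw [h.as_sum]
    refine Submodule.sum_mem _ fun t ht => ?_
    have : monomial t (coeff t h) = coeff t h • (monomial t (1 : ℝ) : RPoly n) := by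
      simp [smul_monomial]
    rw [this]
    exact Submodule.smul_mem _ _ (Submodule.subset_span ⟨t, hh ht, rfl⟩)

/-! ### Norms -/

theorem evalVec_polyOfVec (X : Finset (Fin n → ℝ)) {T : Finset (Term n)} (v : T → ℝ) :
    evalVec X (polyOfVec v) = WithLp.toLp 2 (evalMatrix X T *ᵥ v) := by
  ext x
  simp only [evalVec, polyOfVec, evalMatrix, map_sum, Matrix.mulVec, dotProduct, Matrix.of_apply,
    eval_monomial]
  exact Finset.sum_congr rfl fun t _ => by ring

theorem dotProduct_gram {ι κ : Type*} [Fintype ι] [Fintype κ] (M : Matrix κ ι ℝ) (v : ι → ℝ) :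
    v ⬝ᵥ ((Mᵀ * M) *ᵥ v) = (M *ᵥ v) ⬝ᵥ (M *ᵥ v) := by
  rw [← Matrix.mulVec_mulVec, Matrix.dotProduct_mulVec, Matrix.vecMul_transpose]

theorem norm_evalVec_polyOfVec_sq (X : Finset (Fin n → ℝ)) {T : Finset (Term n)} (v : T → ℝ) :
    ‖evalVec X (polyOfVec v)‖ ^ 2 = v ⬝ᵥ (((evalMatrix X T)ᵀ * evalMatrix X T) *ᵥ v) := by
  rw [dotProduct_gram, evalVec_polyOfVec, EuclideanSpace.real_norm_sq_eq]
  simp [dotProduct, sq]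

theorem evalVec_smul (X : Finset (Fin n → ℝ)) (c : ℝ) (h : RPoly n) :
    evalVec X (c • h) = c • evalVec X h := by
  ext x
  simp [evalVec, smul_eval]

theorem gwNorm_sq_of_support_subset (X : Finset (Fin n → ℝ)) {T : Finset (Term n)} {h : RPoly n}
    (hh : h.support ⊆ T) :
    gwNorm X h ^ 2 = ∑ t ∈ T, coeff t h ^ 2 * gradNorm X (monomial t 1) ^ 2 := by
  rw [gwNorm, Real.sq_sqrt (Finset.sum_nonneg fun t _ => by positivity)]
  refine Finset.sum_subset hh fun t _ ht => ?_
  simp [notMem_support_iff.1 ht]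

theorem gwNorm_nonneg (X : Finset (Fin n → ℝ)) (h : RPoly n) : 0 ≤ gwNorm X h :=
  Real.sqrt_nonneg _

theorem gwNorm_monomial_sq (X : Finset (Fin n → ℝ)) (t : Term n) :
    gwNorm X (monomial t 1) ^ 2 = gradNorm X (monomial t 1) ^ 2 := by
  classical
  rw [gwNorm_sq_of_support_subset X (T := {t}) support_monomial_subset]
  simp

theorem weight_quadratic (X : Finset (Fin n → ℝ)) {T : Finset (Term n)} (v : T → ℝ) :
    v ⬝ᵥ ((weightMatrix X T ^ 2) *ᵥ v) = gwNorm X (polyOfVec v) ^ 2 := by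
  rw [gwNorm_sq_of_support_subset X (support_polyOfVec_subset v), weightMatrix,
    Matrix.diagonal_pow, ← Finset.sum_coe_sort]
  simp only [dotProduct, Matrix.mulVec_diagonal, Pi.pow_apply, coeff_polyOfVec]
  exact Finset.sum_congr rfl fun t _ => by rw [gwNorm_monomial_sq]; ring

theorem gwNorm_smul (X : Finset (Fin n → ℝ)) (c : ℝ) (h : RPoly n) :
    gwNorm X (c • h) = |c| * gwNorm X h := by
  rw [← abs_of_nonneg (gwNorm_nonneg X h), ← abs_of_nonneg (gwNorm_nonneg X (c • h)), ← abs_mul]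
  refine (sq_eq_sq_iff_abs_eq_abs _ _).1 ?_
  rw [mul_pow, gwNorm_sq_of_support_subset X (support_smul (a := c) (f := h)),
    gwNorm_sq_of_support_subset X subset_rfl, Finset.mul_sum]
  exact Finset.sum_congr rfl fun t _ => by simp only [coeff_smul, smul_eq_mul]; ring

/-- The value is `0 / 0 = 0`. This is the weight that makes `D` singular. -/
theorem gradNorm_zero_term (X : Finset (Fin n → ℝ)) :
    gradNorm X (monomial (0 : Term n) 1) = 0 := by
  simp [gradNorm]

/-- The gradient norm of `xₖ o` is nonzero if `o` does not vanish on `X`. -/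
theorem gradNorm_single_add_ne_zero {X : Finset (Fin n → ℝ)} {o : Term n} (k : Fin n)
    (h : evalVec X (monomial o 1) ≠ 0) :
    gradNorm X (monomial (Finsupp.single k 1 + o) 1) ≠ 0 := by
  classical
  refine div_ne_zero ?_ ?_
  · rw [norm_ne_zero_iff]
    -- `∂ₖ(xₖ o) = (1 + oₖ) o`, so a vanishing gradient forces `o` to vanish on `X`.
    contrapose! h
    ext x
    have hx := congrArg (fun u => u (x, k)) h
    have h0 : ((1 : ℝ) + o k) ≠ 0 := by positivity
    simp only [gradVec, pderiv_monomial, add_tsub_cancel_left, eval_monomial, one_mul,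
      Finsupp.coe_add, Pi.add_apply, Finsupp.single_eq_same, Nat.cast_add, Nat.cast_one,
      PiLp.zero_apply, mul_eq_zero, h0, false_or] at hx
    simpa only [evalVec, eval_monomial, one_mul, PiLp.zero_apply] using hx
  · refine (Real.sqrt_pos.2 ?_).ne'
    refine Finset.sum_pos' (fun i _ => by positivity) ⟨k, Finset.mem_univ _, ?_⟩
    rw [degreeOf_monomial_eq _ _ one_ne_zero]
    simp only [Finsupp.coe_add, Pi.add_apply, Finsupp.single_eq_same]
    positivity

/-! ### Treatment of a border term -/

section Treatment

variable {X : Finset (Fin n → ℝ)} {ε : ℝ} {O T : Finset (Term n)} {b : Term n}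

/-- Only the term `1` may have weight zero, so `h` is a constant, and its value at a point of `X` is
zero. -/
theorem eq_zero_of_gwNorm_eq_zero (hX : X.Nonempty)
    (hT : ∀ t ∈ T, t ≠ 0 → gradNorm X (monomial t 1) ≠ 0) {h : RPoly n} (hh : h.support ⊆ T)
    (hg : gwNorm X h = 0) (he : evalVec X h = 0) : h = 0 := by
  have hsum := gwNorm_sq_of_support_subset X hh
  rw [hg, zero_pow two_ne_zero, eq_comm, Finset.sum_eq_zero_iff_of_nonneg
    fun t _ => by positivity] at hsum
  have hc : ∀ t, t ≠ 0 → coeff t h = 0 := fun t ht => by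
    by_cases htT : t ∈ T
    · simpa [hT t htT ht] using hsum t htT
    · exact notMem_support_iff.1 fun h' => htT (hh h')
  have hC : h = C (coeff 0 h) := by
    ext t
    rw [coeff_C]
    split_ifs with ht
    · rw [ht]
    · exact hc t (Ne.symm ht)
  obtain ⟨x, hx⟩ := hX
  have hx' := congrArg (fun u => u ⟨x, hx⟩) he
  rw [hC] at hx'
  simp only [evalVec, eval_C, PiLp.zero_apply] at hx'
  rw [hC, hx', C_0]

/-- The properties of the set of order terms on which the algorithm relies. -/
structure Admissible (X : Finset (Fin n → ℝ)) (ε : ℝ) (O : Finset (Term n)) : Prop where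
  zero_mem : 0 ∈ O
  gradNorm_ne_zero : ∀ t ∈ O, t ≠ 0 → gradNorm X (monomial t 1) ≠ 0
  lt_norm : ∀ h : RPoly n, h.support ⊆ O → gwNorm X h = 1 → ε < ‖evalVec X h‖

/-- Constants have gradient-weighted norm `0`, so the norm bound is vacuous. -/
theorem admissible_singleton_zero : Admissible X ε {0} where
  zero_mem := Finset.mem_singleton_self 0
  gradNorm_ne_zero t ht h0 := absurd (Finset.mem_singleton.1 ht) h0
  lt_norm h hh h1 := by
    have := gwNorm_sq_of_support_subset X hh
    rw [h1, Finset.sum_singleton, gradNorm_zero_term] at this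
    norm_num at this

/-- If the gradient-weighted norm were nonzero, rescaling would give a unitary polynomial of
evaluation norm `0 ≤ ε`. -/
theorem Admissible.eq_zero_of_evalVec (hO : Admissible X ε O) (hX : X.Nonempty) (hε : 0 ≤ ε)
    {h : RPoly n} (hh : h.support ⊆ O) (he : evalVec X h = 0) : h = 0 := by
  refine eq_zero_of_gwNorm_eq_zero hX hO.gradNorm_ne_zero hh ?_ he
  by_contra hg
  have h1 := hO.lt_norm ((gwNorm X h)⁻¹ • h) (support_smul.trans hh) (by
    rw [gwNorm_smul, abs_of_nonneg (inv_nonneg.2 (gwNorm_nonneg X h)), inv_mul_cancel₀ hg])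
  rw [evalVec_smul, he, smul_zero, norm_zero] at h1
  exact absurd h1 hε.not_gt

theorem mem_border {O : Finset (Term n)} {b : Term n} :
    b ∈ border O ↔ (∃ k, ∃ o ∈ O, Finsupp.single k 1 + o = b) ∧ b ∉ O := by
  simp [border]

theorem Admissible.insert_gradNorm_ne_zero (hO : Admissible X ε O) (hX : X.Nonempty)
    (hε : 0 ≤ ε) (hb : b ∈ border O) :
    ∀ t ∈ insert b O, t ≠ 0 → gradNorm X (monomial t 1) ≠ 0 := by
  intro t ht ht0
  obtain rfl | ht := Finset.mem_insert.1 ht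
  · obtain ⟨⟨k, o, ho, rfl⟩, -⟩ := mem_border.1 hb
    refine gradNorm_single_add_ne_zero k fun h => ?_
    have := hO.eq_zero_of_evalVec hX hε
      (support_monomial_subset.trans (Finset.singleton_subset_iff.2 ho)) h
    simp at this
  · exact hO.gradNorm_ne_zero t ht ht0

theorem exists_solvesGEP_terms (hX : X.Nonempty)
    (hT : ∀ t ∈ T, t ≠ 0 → gradNorm X (monomial t 1) ≠ 0) (hb : b ∈ T) (hb0 : b ≠ 0) :
    ∃ l v, SolvesGEP ((evalMatrix X T)ᵀ * evalMatrix X T) (weightMatrix X T ^ 2) l v ∧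
      ∀ w, l * (w ⬝ᵥ ((weightMatrix X T ^ 2) *ᵥ w)) ≤
        w ⬝ᵥ (((evalMatrix X T)ᵀ * evalMatrix X T) *ᵥ w) := by
  classical
  -- The coordinate vector of `b` witnesses that `D² ≠ 0`, as `b ≠ 1` has positive weight.
  refine exists_solvesGEP (u := fun t => coeff (t : Term n) (monomial b (1 : ℝ))) ?_ ?_ ?_ ?_
  · simpa using Matrix.posSemidef_conjTranspose_mul_self (evalMatrix X T)
  · rw [weightMatrix, Matrix.diagonal_pow]
    exact Matrix.PosSemidef.diagonal fun t => sq_nonneg _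
  · intro w hw
    rw [weight_quadratic, ← norm_evalVec_polyOfVec_sq]
    by_contra! hle
    refine hw (funext fun t => ?_)
    have h1 : ‖evalVec X (polyOfVec w)‖ ^ 2 = 0 := by nlinarith [sq_nonneg (gwNorm X (polyOfVec w))]
    have h2 : gwNorm X (polyOfVec w) ^ 2 = 0 := by nlinarith
    have h0 := eq_zero_of_gwNorm_eq_zero hX hT (support_polyOfVec_subset w)
      (pow_eq_zero_iff two_ne_zero |>.1 h2) (norm_eq_zero.1 (pow_eq_zero_iff two_ne_zero |>.1 h1))
    rw [← coeff_polyOfVec w t, h0, coeff_zero, Pi.zero_apply]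
  · rw [weight_quadratic, polyOfVec_coeff
      (support_monomial_subset.trans (Finset.singleton_subset_iff.2 hb)), gwNorm_monomial_sq]
    have := hT b hb hb0
    positivity

theorem SolvesGEP.norm_evalVec_sq {l : ℝ} {v : T → ℝ}
    (h : SolvesGEP ((evalMatrix X T)ᵀ * evalMatrix X T) (weightMatrix X T ^ 2) l v) :
    ‖evalVec X (polyOfVec v)‖ ^ 2 = l := by
  rw [norm_evalVec_polyOfVec_sq, h.2.1, dotProduct_smul, h.2.2, smul_eq_mul, mul_one]

theorem SolvesGEP.sqrt_eq {l : ℝ} {v : T → ℝ}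
    (h : SolvesGEP ((evalMatrix X T)ᵀ * evalMatrix X T) (weightMatrix X T ^ 2) l v) :
    Real.sqrt l = ‖evalVec X (polyOfVec v)‖ := by
  rw [← h.norm_evalVec_sq, Real.sqrt_sq (norm_nonneg _)]

theorem SolvesGEP.gwNorm_eq_one {l : ℝ} {v : T → ℝ}
    (h : SolvesGEP ((evalMatrix X T)ᵀ * evalMatrix X T) (weightMatrix X T ^ 2) l v) :
    gwNorm X (polyOfVec v) = 1 := by
  have := h.2.2
  rw [weight_quadratic] at this
  exact (pow_eq_one_iff_of_nonneg (gwNorm_nonneg X _) two_ne_zero).1 this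

theorem exists_abmTreat (hO : Admissible X ε O) (hX : X.Nonempty) (hε : 0 ≤ ε)
    (hb : b ∈ border O) : ∃ r, abmTreat X ε O b r := by
  have hb0 : b ≠ 0 := fun h => (mem_border.1 hb).2 (h ▸ hO.zero_mem)
  obtain ⟨l, v, h, -⟩ := exists_solvesGEP_terms hX (hO.insert_gradNorm_ne_zero hX hε hb)
    (Finset.mem_insert_self b O) hb0
  obtain hl | hl := le_or_gt (Real.sqrt l) ε
  · exact ⟨_, l, v, h, Or.inl ⟨hl, rfl⟩⟩
  · exact ⟨_, l, v, h, Or.inr ⟨hl, rfl⟩⟩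

theorem abmTreat_some {g : RPoly n} (h : abmTreat X ε O b (some g)) :
    g.support ⊆ insert b O ∧ gwNorm X g = 1 ∧ ‖evalVec X g‖ ≤ ε := by
  obtain ⟨l, v, h, ⟨hl, hg⟩ | ⟨-, hg⟩⟩ := h
  · obtain rfl := Option.some.inj hg
    exact ⟨support_polyOfVec_subset v, h.gwNorm_eq_one, h.sqrt_eq ▸ hl⟩
  · cases hg

/-- When `b` becomes an order term, the least eigenvalue exceeds `ε²`, and it bounds the Rayleigh
quotient on the whole enlarged span. -/
theorem Admissible.insert (hO : Admissible X ε O) (hX : X.Nonempty) (hε : 0 ≤ ε)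
    (hb : b ∈ border O) (h : abmTreat X ε O b none) : Admissible X ε (insert b O) where
  zero_mem := Finset.mem_insert_of_mem hO.zero_mem
  gradNorm_ne_zero := hO.insert_gradNorm_ne_zero hX hε hb
  lt_norm p hp hp1 := by
    have hb0 : b ≠ 0 := fun h => (mem_border.1 hb).2 (h ▸ hO.zero_mem)
    obtain ⟨l, v, h, ⟨-, hg⟩ | ⟨hl, -⟩⟩ := h
    · cases hg
    obtain ⟨l', v', h', hlow⟩ := exists_solvesGEP_terms hX (hO.insert_gradNorm_ne_zero hX hε hb)
      (Finset.mem_insert_self b O) hb0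
    -- The Rayleigh bound comes with its own eigenpair; both eigenvalues are least, hence equal.
    obtain rfl := h.1.unique h'.1
    have := hlow fun t => coeff (t : Term n) p
    rw [weight_quadratic, ← norm_evalVec_polyOfVec_sq, polyOfVec_coeff hp, hp1, one_pow,
      mul_one] at this
    exact hl.trans_le ((Real.sqrt_le_left (norm_nonneg _)).2 this)

theorem evalVec_polyOfVec_eq_zero {w : T → ℝ} :
    evalVec X (polyOfVec w) = 0 ↔ evalMatrix X T *ᵥ w = 0 := by
  rw [evalVec_polyOfVec, WithLp.toLp_eq_zero]

theorem mulVec_eq_zero_of_solvesGEP_zero {v : T → ℝ}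
    (h : SolvesGEP ((evalMatrix X T)ᵀ * evalMatrix X T) (weightMatrix X T ^ 2) 0 v) :
    evalMatrix X T *ᵥ v = 0 := by
  rw [← evalVec_polyOfVec_eq_zero]
  simpa using h.norm_evalVec_sq

theorem SolvesGEP.ne_zero {ι : Type*} [Fintype ι] {A B : Matrix ι ι ℝ} {l : ℝ} {v : ι → ℝ}
    (h : SolvesGEP A B l v) : v ≠ 0 := by
  rintro rfl
  simpa using h.2.2

theorem zero_mem_genEigenvalues {w : T → ℝ} (hw : w ≠ 0) (h : evalMatrix X T *ᵥ w = 0) :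
    0 ∈ genEigenvalues ((evalMatrix X T)ᵀ * evalMatrix X T) (weightMatrix X T ^ 2) :=
  ⟨w, hw, by rw [← Matrix.mulVec_mulVec, h, Matrix.mulVec_zero, zero_smul]⟩

/-- For `ε = 0` both algorithms treat a border term in the same way. -/
theorem abmTreat_zero_iff_bmTreat (hO : Admissible X 0 O) (hX : X.Nonempty)
    (hb : b ∈ border O) (r : Option (RPoly n)) : abmTreat X 0 O b r ↔ bmTreat X O b r := by
  have hb0 : b ≠ 0 := fun h => (mem_border.1 hb).2 (h ▸ hO.zero_mem)
  have hT := hO.insert_gradNorm_ne_zero hX le_rfl hb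
  constructor
  · rintro ⟨l, v, h, ⟨hl, rfl⟩ | ⟨hl, rfl⟩⟩
    · have hl0 : l = 0 := by
        rw [h.sqrt_eq] at hl
        rw [← h.norm_evalVec_sq, le_antisymm hl (norm_nonneg _), zero_pow two_ne_zero]
      subst hl0
      refine Or.inl ⟨v, h.ne_zero, mulVec_eq_zero_of_solvesGEP_zero h, ?_⟩
      rw [h.gwNorm_eq_one, inv_one, one_smul]
    · refine Or.inr ⟨?_, rfl⟩
      rw [← Matrix.mulVec_injective_iff, ← Matrix.coe_mulVecLin, injective_iff_map_eq_zero]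
      intro w hw
      by_contra hw0
      exact absurd (Real.sqrt_pos.1 hl) (h.1.2 (zero_mem_genEigenvalues hw0 hw)).not_gt
  · rintro (⟨w, hw, hMw, rfl⟩ | ⟨hli, rfl⟩)
    · have he := evalVec_polyOfVec_eq_zero.2 hMw
      -- The division in the exact algorithm is thus legitimate for every nonzero kernel vector.
      have hg : gwNorm X (polyOfVec w) ≠ 0 := fun hg => by
        have h0 := eq_zero_of_gwNorm_eq_zero hX hT (support_polyOfVec_subset w) hg he
        exact hw (funext fun t => by rw [← coeff_polyOfVec w t, h0, coeff_zero, Pi.zero_apply])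
      have hMv : ∀ c : ℝ, ((evalMatrix X (insert b O))ᵀ * evalMatrix X (insert b O)) *ᵥ (c • w) = 0 :=
        fun c => by rw [← Matrix.mulVec_mulVec, Matrix.mulVec_smul, hMw, smul_zero,
          Matrix.mulVec_zero]
      refine ⟨0, (gwNorm X (polyOfVec w))⁻¹ • w, ⟨⟨zero_mem_genEigenvalues hw hMw, ?_⟩, ?_, ?_⟩,
        Or.inl ⟨by simp, by rw [polyOfVec_smul]⟩⟩
      · obtain ⟨l, v, h, -⟩ := exists_solvesGEP_terms hX hT (Finset.mem_insert_self b O) hb0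
        intro m hm
        exact (h.norm_evalVec_sq ▸ sq_nonneg _ : (0 : ℝ) ≤ l).trans (h.1.2 hm)
      · rw [hMv, zero_smul]
      · rw [weight_quadratic, polyOfVec_smul, gwNorm_smul,
          abs_of_nonneg (inv_nonneg.2 (gwNorm_nonneg X _)), inv_mul_cancel₀ hg, one_pow]
    · obtain ⟨l, v, h, -⟩ := exists_solvesGEP_terms hX hT (Finset.mem_insert_self b O) hb0
      refine ⟨l, v, h, Or.inr ⟨?_, rfl⟩⟩
      rw [← Matrix.mulVec_injective_iff, ← Matrix.coe_mulVecLin, injective_iff_map_eq_zero] at hli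
      rw [h.sqrt_eq]
      refine norm_pos_iff.2 fun h0 => h.ne_zero (hli v (evalVec_polyOfVec_eq_zero.1 h0))

end Treatment

/-! ### Approximate vanishing ideals -/

section Ideal

variable {X : Finset (Fin n → ℝ)} {ε : ℝ}

theorem coeffNorm_sq (g : RPoly n) : coeffNorm g ^ 2 = ∑ t ∈ g.support, coeff t g ^ 2 :=
  Real.sq_sqrt (Finset.sum_nonneg fun _ _ => sq_nonneg _)

theorem abs_coeff_le_coeffNorm (g : RPoly n) (t : Term n) : |coeff t g| ≤ coeffNorm g := by
  refine abs_le_of_sq_le_sq ?_ (Real.sqrt_nonneg _)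
  rw [coeffNorm_sq]
  by_cases ht : t ∈ g.support
  · exact Finset.single_le_sum (f := fun t => coeff t g ^ 2) (fun _ _ => sq_nonneg _) ht
  · rw [notMem_support_iff.1 ht, zero_pow two_ne_zero]
    exact Finset.sum_nonneg fun t _ => sq_nonneg _

theorem coeffNorm_pos {g : RPoly n} (hg : g ≠ 0) : 0 < coeffNorm g := by
  obtain ⟨t, ht⟩ := ne_zero_iff.1 hg
  exact (abs_pos.2 ht).trans_le (abs_coeff_le_coeffNorm g t)

theorem isUnitary_inv_coeffNorm_smul {g : RPoly n} (hg : g ≠ 0) :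
    IsUnitary ((coeffNorm g)⁻¹ • g) := by
  have h := coeffNorm_pos hg
  refine (pow_eq_one_iff_of_nonneg (Real.sqrt_nonneg _) two_ne_zero).1 ?_
  have hs : ((coeffNorm g)⁻¹ • g).support = g.support :=
    support_smul_eq (inv_ne_zero h.ne') g
  change coeffNorm _ ^ 2 = 1
  rw [coeffNorm_sq, hs]
  simp only [coeff_smul, smul_eq_mul, mul_pow]
  rw [← Finset.mul_sum, ← coeffNorm_sq, ← mul_pow, inv_mul_cancel₀ h.ne', one_pow]

/-- A finite set of points of a space of positive dimension lies on a hypersurface. -/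
theorem exists_ne_zero_vanishing (X : Finset (Fin n → ℝ)) (k : Fin n) :
    ∃ p : RPoly n, p ≠ 0 ∧ ∀ x ∈ X, eval x p = 0 := by
  refine ⟨∏ x ∈ X, (MvPolynomial.X k - C (x k)), Finset.prod_ne_zero_iff.2 fun x _ h => ?_,
    fun x hx => ?_⟩
  · have := congrArg (eval fun _ => x k + 1) h
    simp at this
  · rw [map_prod]
    exact Finset.prod_eq_zero hx (by simp)

theorem mem_span_smul {H : Set (RPoly n)} {c : ℝ} (hc : c ≠ 0) {g : RPoly n}
    (h : c • g ∈ Ideal.span H) : g ∈ Ideal.span H := by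
  have := (Ideal.span H).mul_mem_left (C c⁻¹) h
  rwa [← smul_eq_C_mul, smul_smul, inv_mul_cancel₀ hc, one_smul] at this

/-- Adding multiples that vanish on `X` makes the coefficient norm of a generator at least `1`, so
that it stays approximately vanishing after normalization. -/
theorem isApproxVanishingIdeal_span (hε : 0 ≤ ε) {G : Set (RPoly n)}
    (hG : ∀ g ∈ G, IsGWUnitary X g ∧ IsApproxVanishing ε X g) :
    IsApproxVanishingIdeal ε X (Ideal.span G) := by
  set H := {h | h ∈ Ideal.span G ∧ IsUnitary h ∧ IsApproxVanishing ε X h} with hH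
  -- This inequality says exactly that `f` is `ε`-approximately vanishing after division by its
  -- coefficient norm.
  have hmem : ∀ f ∈ Ideal.span G, f ≠ 0 → ‖evalVec X f‖ ≤ coeffNorm f * ε →
      f ∈ Ideal.span H := fun f hf hf0 hfε => by
    have hpos := coeffNorm_pos hf0
    refine mem_span_smul (inv_ne_zero hpos.ne') (Ideal.subset_span
      ⟨?_, isUnitary_inv_coeffNorm_smul hf0, ?_⟩)
    · rw [smul_eq_C_mul]
      exact Ideal.mul_mem_left _ _ hf
    · rwa [IsApproxVanishing, evalVec_smul, norm_smul, norm_inv, Real.norm_of_nonneg hpos.le,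
        inv_mul_le_iff₀ hpos]
  refine ⟨H, fun h hh => hh.2,
    le_antisymm (Ideal.span_le.2 fun h hh => hh.1) (Ideal.span_le.2 fun g hg => ?_)⟩
  obtain ⟨hg1, hgε⟩ := hG g hg
  obtain ⟨t, ht0, ht⟩ : ∃ t : Term n, t ≠ 0 ∧ coeff t g ≠ 0 := by
    by_contra! h
    have hs : g.support ⊆ {0} := fun t ht => by
      by_contra ht0
      exact mem_support_iff.1 ht (h t (by simpa using ht0))
    have h1 := gwNorm_sq_of_support_subset X hs
    rw [show gwNorm X g = 1 from hg1, Finset.sum_singleton, gradNorm_zero_term] at h1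
    norm_num at h1
  -- A nonconstant term is needed only to supply a variable.
  obtain ⟨k, -⟩ := Finsupp.ne_iff.1 ht0
  obtain ⟨p, hp, hpX⟩ := exists_ne_zero_vanishing X k
  have hg0 : g ≠ 0 := ne_zero_iff.2 ⟨t, ht⟩
  have hpg : p * g ≠ 0 := mul_ne_zero hp hg0
  have hpg_eval : evalVec X (p * g) = 0 := by
    ext x
    simp [evalVec, hpX x x.2]
  obtain ⟨s, hs⟩ := ne_zero_iff.1 hpg
  obtain ⟨c, hc⟩ : ∃ c : ℝ, coeff s (g + c • (p * g)) = 1 :=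
    ⟨(1 - coeff s g) / coeff s (p * g), by
      rw [coeff_add, coeff_smul, smul_eq_mul, div_mul_cancel₀ _ hs, add_sub_cancel]⟩
  set q := g + c • (p * g) with hq
  have hq1 : 1 ≤ coeffNorm q := by simpa [hc] using abs_coeff_le_coeffNorm q s
  have hq0 : q ≠ 0 := ne_zero_iff.2 ⟨s, hc ▸ one_ne_zero⟩
  have hq_eval : evalVec X q = evalVec X g := by
    ext x
    simp [evalVec, hq, hpX x x.2, smul_eval]
  have hgI : g ∈ Ideal.span G := Ideal.subset_span hg
  have hpgI : p * g ∈ Ideal.span G := Ideal.mul_mem_left _ _ hgI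
  have h1 := hmem _ hpgI hpg (by
    rw [hpg_eval, norm_zero]
    exact mul_nonneg (coeffNorm_pos hpg).le hε)
  have h2 := hmem q (add_mem hgI (smul_eq_C_mul (p * g) c ▸ Ideal.mul_mem_left _ _ hpgI)) hq0 (by
    rw [hq_eval]
    exact le_trans hgε (le_mul_of_one_le_left hε hq1))
  have h3 := sub_mem h2 (Ideal.mul_mem_left _ (C c) h1)
  rwa [← smul_eq_C_mul, hq, add_sub_cancel_right] at h3

end Ideal

/-! ### Runs of the algorithm -/

section Runs

variable {X : Finset (Fin n → ℝ)} {ε : ℝ} {σ : MonomialOrder (Fin n)} {O : Finset (Term n)}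
  {b c : Term n} {S S' : State n}

theorem mem_borderOfDegree {d : ℕ} : b ∈ borderOfDegree O d ↔ b ∈ border O ∧ b.degree = d :=
  Finset.mem_filter

theorem mem_border_insert_of_ne (hc : c ∈ border O) (h : c ≠ b) : c ∈ border (insert b O) := by
  obtain ⟨⟨k, o, ho, hk⟩, hcO⟩ := mem_border.1 hc
  exact mem_border.2 ⟨⟨k, o, Finset.mem_insert_of_mem ho, hk⟩, by simp [h, hcO]⟩

theorem degree_single_add (k : Fin n) (o : Term n) :
    (Finsupp.single k 1 + o).degree = o.degree + 1 := by
  rw [map_add, Finsupp.degree_single, add_comm]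

/-- New border terms are multiples `xₖ b`, of degree `deg b + 1`, so accepting `b` creates no work
in degrees up to its own. -/
theorem mem_border_of_mem_border_insert (hc : c ∈ border (insert b O))
    (hd : c.degree ≤ b.degree) : c ∈ border O ∧ c ≠ b := by
  obtain ⟨⟨k, o, ho, rfl⟩, hcO⟩ := mem_border.1 hc
  rw [degree_single_add] at hd
  obtain rfl | ho := Finset.mem_insert.1 ho
  · omega
  · rw [Finset.mem_insert, not_or] at hcO
    exact ⟨mem_border.2 ⟨⟨k, o, ho, rfl⟩, hcO.2⟩, hcO.1⟩

/-- The properties of the polynomial `g` that the border term `b` yields. -/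
structure IsYield (σ : MonomialOrder (Fin n)) (X : Finset (Fin n → ℝ)) (ε : ℝ)
    (O : Finset (Term n)) (b : Term n) (g : RPoly n) : Prop where
  gwNorm_eq_one : gwNorm X g = 1
  norm_le : ‖evalVec X g‖ ≤ ε
  support_subset : g.support ⊆ insert b O
  coeff_ne_zero : coeff b g ≠ 0
  leadingCoeff_eq : σ.leadingCoeff g = coeff b g

theorem IsYield.mono {O' : Finset (Term n)} {g : RPoly n} (h : IsYield σ X ε O b g)
    (hO : O ⊆ O') : IsYield σ X ε O' b g :=
  { h with support_subset := h.support_subset.trans (Finset.insert_subset_insert b hO) }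

/-- Without `b`, `g` would lie in the span of `O` and contradict admissibility. All other terms are
below `b`, so `b` leads. -/
theorem Admissible.isYield {g : RPoly n} (hO : Admissible X ε O) (hb : ∀ o ∈ O, o ≺[σ] b)
    (h : abmTreat X ε O b (some g)) : IsYield σ X ε O b g := by
  obtain ⟨hs, h1, hε⟩ := abmTreat_some h
  have hcoeff : coeff b g ≠ 0 := fun h0 => by
    refine (hO.lt_norm g (fun t ht => ?_) h1).not_ge hε
    refine (Finset.mem_insert.1 (hs ht)).resolve_left ?_
    rintro rfl
    exact mem_support_iff.1 ht h0
  refine ⟨h1, hε, hs, hcoeff, ?_⟩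
  have hdeg : σ.degree g = b := by
    refine σ.toSyn.injective (le_antisymm (σ.degree_le_iff.2 fun t ht => ?_)
      (σ.le_degree (mem_support_iff.2 hcoeff)))
    obtain rfl | ht := Finset.mem_insert.1 (hs ht)
    · exact le_rfl
    · exact (hb t ht).le
  rw [MonomialOrder.leadingCoeff, hdeg]

/-- The invariant of the loop. -/
structure Invariant (σ : MonomialOrder (Fin n)) (X : Finset (Fin n → ℝ)) (ε : ℝ)
    (S : State n) : Prop where
  admissible : Admissible X ε S.O
  mem_border_of_mem : ∀ c ∈ S.L, c ∈ border S.O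
  degree_eq : ∀ c ∈ S.L, c.degree = S.d
  degree_le : ∀ o ∈ S.O, o.degree ≤ S.d
  lt_of_mem : ∀ o ∈ S.O, ∀ c ∈ S.L, o ≺[σ] c
  exists_degree : ∀ e < S.d, ∃ o ∈ S.O, o.degree = e
  -- `R` collects the border terms that have yielded a polynomial, and `γ` records which one.
  exists_yield : ∃ (R : Set (Term n)) (γ : Term n → RPoly n), S.G = γ '' R ∧
    (∀ b ∈ R, b ∈ border S.O ∧ b.degree ≤ S.d ∧ b ∉ S.L ∧ IsYield σ X ε S.O b (γ b)) ∧
    ∀ b ∈ border S.O, b.degree ≤ S.d → b ∈ R ∨ b ∈ S.L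

theorem invariant_initState : Invariant σ X ε (initState n) where
  admissible := admissible_singleton_zero
  mem_border_of_mem c hc := absurd hc (Finset.notMem_empty c)
  degree_eq c hc := absurd hc (Finset.notMem_empty c)
  degree_le o ho := by
    rw [Finset.mem_singleton.1 ho, map_zero]
    exact Nat.zero_le _
  lt_of_mem o _ c hc := absurd hc (Finset.notMem_empty c)
  exists_degree e he := absurd he (Nat.not_lt_zero e)
  exists_yield := by
    refine ⟨∅, fun _ => 0, by simp [initState], by simp, fun b hb hd => ?_⟩
    obtain ⟨⟨k, o, ho, rfl⟩, -⟩ := mem_border.1 hb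
    rw [degree_single_add] at hd
    exact absurd hd (Nat.not_succ_le_zero _)

/-- Order terms stay below pending terms: on entering a new degree by degree compatibility, within a
degree by the ascending order of treatment. -/
theorem Invariant.step (hX : X.Nonempty) (hε : 0 ≤ ε) (hσ : IsDegreeCompatible σ)
    (hS : Invariant σ X ε S) (h : Step (abmTreat X ε) σ S S') : Invariant σ X ε S' := by
  cases h with
  | nextDegree G O d h =>
    obtain ⟨hadm, -, -, hdeg, -, hex, R, γ, hG, hR, hbR⟩ := hS
    dsimp only at *
    refine ⟨hadm, fun c hc => (mem_borderOfDegree.1 hc).1, fun c hc => (mem_borderOfDegree.1 hc).2,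
      fun o ho => (hdeg o ho).trans (Nat.le_succ d), fun o ho c hc => hσ o c ?_, fun e he => ?_,
      R, γ, hG, fun b hb => ?_, fun b hb hd => ?_⟩
    · rw [(mem_borderOfDegree.1 hc).2]
      exact Nat.lt_succ_of_le (hdeg o ho)
    · obtain he | rfl := Nat.lt_succ_iff_lt_or_eq.1 he
      · exact hex e he
      -- A border term of degree `d + 1` is `xₖ o` with `o` an order term of degree `d`.
      · obtain ⟨c, hc⟩ := Finset.nonempty_iff_ne_empty.2 h
        obtain ⟨hc, hcd⟩ := mem_borderOfDegree.1 hc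
        obtain ⟨⟨k, o, ho, rfl⟩, -⟩ := mem_border.1 hc
        rw [degree_single_add] at hcd
        exact ⟨o, ho, Nat.succ_injective hcd⟩
    · obtain ⟨h1, h2, -, h4⟩ := hR b hb
      refine ⟨h1, h2.trans (Nat.le_succ d), fun hL => ?_, h4⟩
      have := (mem_borderOfDegree.1 hL).2
      omega
    · obtain hd | hd := Nat.le_succ_iff.1 hd
      · exact Or.inl ((hbR b hb hd).resolve_right (Finset.notMem_empty b))
      · exact Or.inr (mem_borderOfDegree.2 ⟨hb, hd⟩)
  | addPolynomial G O d L b g hb hg =>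
    obtain ⟨hadm, hborder, hLd, hdeg, hlt, hex, R, γ, hG, hR, hbR⟩ := hS
    dsimp only at *
    have hbR' : b ∉ R := fun h => (hR b h).2.2.1 hb.1
    have hγ : ∀ c ∈ R, Function.update γ b g c = γ c := fun c hc =>
      Function.update_of_ne (ne_of_mem_of_not_mem hc hbR') g γ
    refine ⟨hadm, fun c hc => hborder c (Finset.mem_of_mem_erase hc),
      fun c hc => hLd c (Finset.mem_of_mem_erase hc), hdeg,
      fun o ho c hc => hlt o ho c (Finset.mem_of_mem_erase hc), hex,
      insert b R, Function.update γ b g, ?_, ?_, fun c hc hd => ?_⟩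
    · rw [Set.image_insert_eq, Function.update_self, Set.image_congr hγ, hG, Set.union_singleton]
    · rintro c (rfl | hc)
      · refine ⟨hborder c hb.1, (hLd c hb.1).le, Finset.notMem_erase c L, ?_⟩
        rw [Function.update_self]
        exact hadm.isYield (fun o ho => hlt o ho c hb.1) hg
      · rw [hγ c hc]
        obtain ⟨h1, h2, h3, h4⟩ := hR c hc
        exact ⟨h1, h2, fun h => h3 (Finset.mem_of_mem_erase h), h4⟩
    · by_cases hcb : c = b
      · exact Or.inl (Or.inl hcb)
      · exact (hbR c hc hd).imp Or.inr fun h => Finset.mem_erase.2 ⟨hcb, h⟩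
  | addTerm G O d L b hb hg =>
    obtain ⟨hadm, hborder, hLd, hdeg, hlt, hex, R, γ, hG, hR, hbR⟩ := hS
    dsimp only at *
    have hbd := hLd b hb.1
    refine ⟨hadm.insert hX hε (hborder b hb.1) hg, fun c hc => ?_,
      fun c hc => hLd c (Finset.mem_of_mem_erase hc), fun o ho => ?_, fun o ho c hc => ?_,
      fun e he => ?_, R, γ, hG, fun c hc => ?_, fun c hc hd => ?_⟩
    · exact mem_border_insert_of_ne (hborder c (Finset.mem_of_mem_erase hc))
        (Finset.ne_of_mem_erase hc)
    · obtain rfl | ho := Finset.mem_insert.1 ho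
      · exact hbd.le
      · exact hdeg o ho
    · have hcb := Finset.ne_of_mem_erase hc
      replace hc := Finset.mem_of_mem_erase hc
      obtain rfl | ho := Finset.mem_insert.1 ho
      · exact (hb.2 c hc).lt_of_ne fun h => hcb (σ.toSyn.injective h).symm
      · exact hlt o ho c hc
    · obtain ⟨o, ho, hoe⟩ := hex e he
      exact ⟨o, Finset.mem_insert_of_mem ho, hoe⟩
    · obtain ⟨h1, h2, h3, h4⟩ := hR c hc
      refine ⟨mem_border_insert_of_ne h1 ?_, h2, fun h => h3 (Finset.mem_of_mem_erase h),
        h4.mono (Finset.subset_insert b O)⟩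
      rintro rfl
      exact h3 hb.1
    · obtain ⟨hc, hcb⟩ := mem_border_of_mem_border_insert hc (hbd ▸ hd)
      exact (hbR c hc hd).imp id fun h => Finset.mem_erase.2 ⟨hcb, h⟩

theorem Reachable.invariant (hX : X.Nonempty) (hε : 0 ≤ ε) (hσ : IsDegreeCompatible σ)
    (h : Reachable (abmTreat X ε) σ S) : Invariant σ X ε S := by
  induction h with
  | refl => exact invariant_initState
  | tail _ hstep ih => exact ih.step hX hε hσ hstep

/-! ### Degree bound and termination -/

theorem Admissible.card_le (hO : Admissible X ε O) (hX : X.Nonempty) (hε : 0 ≤ ε) :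
    O.card ≤ X.card := by
  have hinj : Function.Injective (evalMatrix X O).mulVecLin := by
    rw [injective_iff_map_eq_zero]
    intro w hw
    have h0 := hO.eq_zero_of_evalVec hX hε (support_polyOfVec_subset w)
      (evalVec_polyOfVec_eq_zero.2 hw)
    exact funext fun t => by rw [← coeff_polyOfVec w t, h0, coeff_zero, Pi.zero_apply]
  simpa using LinearMap.finrank_le_finrank_of_injective hinj

/-- `O` contains terms of each of the degrees `0, …, d - 1`, hence at least `d` terms. -/
theorem Invariant.degree_le_card (hS : Invariant σ X ε S) (hX : X.Nonempty) (hε : 0 ≤ ε) :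
    S.d ≤ X.card := by
  refine le_trans ?_ (hS.admissible.card_le hX hε)
  have hsub : Finset.range S.d ⊆ S.O.image Finsupp.degree := fun e he => by
    obtain ⟨o, ho, hoe⟩ := hS.exists_degree e (Finset.mem_range.1 he)
    exact Finset.mem_image.2 ⟨o, ho, hoe⟩
  simpa using (Finset.card_le_card hsub).trans Finset.card_image_le

theorem exists_isSmallest (σ : MonomialOrder (Fin n)) {L : Finset (Term n)} (hL : L.Nonempty) :
    ∃ b, IsSmallest σ L b :=
  (L.exists_min_image σ.toSyn hL).imp fun _ h => h

theorem Invariant.isFinal_or_exists_step (hS : Invariant σ X ε S) (hX : X.Nonempty)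
    (hε : 0 ≤ ε) : IsFinal S ∨ ∃ S', Step (abmTreat X ε) σ S S' := by
  obtain ⟨G, O, d, L⟩ := S
  obtain rfl | hL := L.eq_empty_or_nonempty
  · by_cases h : borderOfDegree O (d + 1) = ∅
    · exact Or.inl ⟨rfl, h⟩
    · exact Or.inr ⟨_, Step.nextDegree G O d h⟩
  · obtain ⟨b, hb⟩ := exists_isSmallest σ hL
    obtain ⟨_ | g, hr⟩ := exists_abmTreat hS.admissible hX hε (hS.mem_border_of_mem b hb.1)
    · exact Or.inr ⟨_, Step.addTerm G O d L b hb hr⟩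
    · exact Or.inr ⟨_, Step.addPolynomial G O d L b g hb hr⟩

/-- A step either raises the degree, possibly refilling `L`, or removes a term from `L`; hence the
lexicographic order. -/
theorem Step.measure_lt {treat : Finset (Term n) → Term n → Option (RPoly n) → Prop} {N : ℕ}
    (h : Step treat σ S S') (hN : S'.d ≤ N) :
    toLex (N - S'.d, S'.L.card) < toLex (N - S.d, S.L.card) := by
  rw [Prod.Lex.toLex_lt_toLex]
  cases h with
  | nextDegree G O d h =>
    dsimp only at *
    left
    omega
  | addPolynomial G O d L b g hb hg => exact Or.inr ⟨rfl, Finset.card_erase_lt_of_mem hb.1⟩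
  | addTerm G O d L b hb hg => exact Or.inr ⟨rfl, Finset.card_erase_lt_of_mem hb.1⟩

theorem terminates_abmTreat (hX : X.Nonempty) (hε : 0 ≤ ε) (hσ : IsDegreeCompatible σ) :
    Terminates (abmTreat X ε) σ := by
  refine ⟨fun S hS => (hS.invariant hX hε hσ).isFinal_or_exists_step hX hε, ?_⟩
  rintro ⟨run, h0, hrun⟩
  have hinv : ∀ i, Invariant σ X ε (run i) := fun i => by
    induction i with
    | zero => exact h0 ▸ invariant_initState
    | succ i ih => exact ih.step hX hε hσ (hrun i)
  refine not_strictAnti_of_wellFoundedLT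
    (fun i => toLex (X.card - (run i).d, (run i).L.card)) (strictAnti_nat_of_succ_lt fun i => ?_)
  exact (hrun i).measure_lt ((hinv (i + 1)).degree_le_card hX hε)

/-! ### The border prebasis -/

theorem Invariant.isBorderPrebasis (hS : Invariant σ X ε S) (hF : IsFinal S)
    (hO : IsOrderIdeal S.O) :
    IsBorderPrebasis S.O {p | ∃ g ∈ S.G, p = (1 / σ.leadingCoeff g) • g} := by
  obtain ⟨R, γ, hG, hR, hbR⟩ := hS.exists_yield
  have hRborder : ∀ b, b ∈ R ↔ b ∈ border S.O := fun b => by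
    refine ⟨fun hb => (hR b hb).1, fun hb => ?_⟩
    have hd : b.degree ≤ S.d := by
      -- Order terms have degree at most `d`, so border terms reach at most `d + 1`, and finality
      -- excludes that value: every border term has been treated.
      have hd' : b.degree ≤ S.d + 1 := by
        obtain ⟨⟨k, o, ho, rfl⟩, -⟩ := mem_border.1 hb
        rw [degree_single_add]
        exact Nat.succ_le_succ (hS.degree_le o ho)
      refine Nat.lt_succ_iff.1 (hd'.lt_of_ne fun h => ?_)
      have := mem_borderOfDegree.2 ⟨hb, h⟩
      rw [hF.2] at this
      exact Finset.notMem_empty b this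
    refine (hbR b hb hd).resolve_right ?_
    rw [hF.1]
    exact Finset.notMem_empty b
  have key : ∀ b ∈ R, (1 / σ.leadingCoeff (γ b)) • γ b =
      monomial b 1 - ∑ o ∈ S.O, monomial o (-(coeff o (γ b) / coeff b (γ b))) := fun b hb => by
    obtain ⟨hbO, -, -, hy⟩ := hR b hb
    have hbO' := (mem_border.1 hbO).2
    have hsum : γ b = monomial b (coeff b (γ b)) + ∑ o ∈ S.O, monomial o (coeff o (γ b)) := by
      conv_lhs => rw [(γ b).as_sum]
      rw [← Finset.sum_insert hbO' (f := fun o => monomial o (coeff o (γ b)))]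
      refine Finset.sum_subset hy.support_subset fun t _ ht => ?_
      rw [notMem_support_iff.1 ht, monomial_zero]
    have ha := hy.coeff_ne_zero
    rw [hy.leadingCoeff_eq]
    generalize coeff b (γ b) = a at hsum ha ⊢
    conv_lhs => rw [hsum]
    simp only [smul_add, Finset.smul_sum, smul_monomial, smul_eq_mul, map_neg,
      Finset.sum_neg_distrib, sub_neg_eq_add, one_div_mul_cancel ha,
      one_div_mul_eq_div]
  refine ⟨hO, fun b o => -(coeff o (γ b) / coeff b (γ b)), Set.ext fun p => ?_⟩
  simp only [hG, Set.exists_mem_image, Set.mem_ofPred_eq]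
  exact exists_congr fun b => ⟨fun ⟨hb, hp⟩ => ⟨(hRborder b).1 hb, hp.trans (key b hb)⟩,
    fun ⟨hb, hp⟩ => ⟨(hRborder b).2 hb, hp.trans (key b ((hRborder b).2 hb)).symm⟩⟩

/-! ### Comparison of runs for `ε = 0` -/

theorem Step.congr {treat treat' : Finset (Term n) → Term n → Option (RPoly n) → Prop}
    (h : ∀ b ∈ S.L, ∀ r, treat S.O b r → treat' S.O b r) (hstep : Step treat σ S S') :
    Step treat' σ S S' := by
  cases hstep with
  | nextDegree G O d h' => exact Step.nextDegree G O d h'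
  | addPolynomial G O d L b g hb hg => exact Step.addPolynomial G O d L b g hb (h b hb.1 _ hg)
  | addTerm G O d L b hb hg => exact Step.addTerm G O d L b hb (h b hb.1 _ hg)

theorem reachable_abmTreat_zero_iff (hX : X.Nonempty) (hσ : IsDegreeCompatible σ) :
    Reachable (abmTreat X 0) σ S ↔ Reachable (bmTreat X) σ S := by
  have htreat : ∀ S : State n, Reachable (abmTreat X 0) σ S → ∀ b ∈ S.L, ∀ r,
      abmTreat X 0 S.O b r ↔ bmTreat X S.O b r := fun S hS b hb r => by
    have := hS.invariant hX le_rfl hσ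
    exact abmTreat_zero_iff_bmTreat this.admissible hX (this.mem_border_of_mem b hb) r
  constructor
  · intro h
    induction h with
    | refl => exact Relation.ReflTransGen.refl
    | tail h hstep ih =>
      exact ih.tail (hstep.congr fun b hb r => (htreat _ h b hb r).1)
  · intro h
    induction h with
    | refl => exact Relation.ReflTransGen.refl
    -- The invariant is known only for ABM runs; the induction hypothesis turns the exact run so far
    -- into one.
    | tail _ hstep ih => exact ih.tail (hstep.congr fun b hb r => (htreat _ ih b hb r).2)

end Runs

end GWBorder

open GWBorder
theorem mainTheorem3 (n : ℕ) (X : Finset (Fin n → ℝ)) (hX : X.Nonempty) (ε : ℝ) (hε : 0 ≤ ε)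
    (σ : MonomialOrder (Fin n)) (hσ : IsDegreeCompatible σ) :
    Terminates (abmTreat X ε) σ ∧
    (∀ (G : Set (RPoly n)) (O : Finset (Term n)), Outputs (abmTreat X ε) σ G O →
      ((∀ g ∈ G, IsGWUnitary X g ∧ IsApproxVanishing ε X g) ∧
        IsApproxVanishingIdeal ε X (Ideal.span G)) ∧
      (¬ ∃ h ∈ termSpan O, IsGWUnitary X h ∧ IsApproxVanishing ε X h) ∧
      (IsOrderIdeal O → IsBorderPrebasis O {p | ∃ g ∈ G, p = (1 / σ.leadingCoeff g) • g})) ∧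
    (ε = 0 → ∀ (G : Set (RPoly n)) (O : Finset (Term n)),
      Outputs (abmTreat X ε) σ G O ↔ Outputs (bmTreat X) σ G O) := by
  refine ⟨terminates_abmTreat hX hε hσ, ?_, ?_⟩
  · rintro _ _ ⟨S, hS, hF, rfl, rfl⟩
    have hinv := hS.invariant hX hε hσ
    have hG : ∀ g ∈ S.G, IsGWUnitary X g ∧ IsApproxVanishing ε X g := fun g hg => by
      obtain ⟨R, γ, hG, hR, -⟩ := hinv.exists_yield
      rw [hG] at hg
      obtain ⟨b, hb, rfl⟩ := hg
      exact ⟨(hR b hb).2.2.2.gwNorm_eq_one, (hR b hb).2.2.2.norm_le⟩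
    refine ⟨⟨hG, isApproxVanishingIdeal_span hε hG⟩, ?_, hinv.isBorderPrebasis hF⟩
    rintro ⟨h, hh, h1, hv⟩
    exact (hinv.admissible.lt_norm h (mem_termSpan_iff.1 hh) h1).not_ge hv
  · rintro rfl G O
    simp only [Outputs, reachable_abmTreat_zero_iff hX hσ]
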